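/- Let $c_0$ be the real Banach space of real sequences converging to $0$, with the sup norm $\|\cdot\|_\infty$. For a real Banach space $X$ with dual $X^*$, let $\operatorname{NA}(X,\mathbb R)$ be the set of those $f\in X^*$ for which there is $x\in X$ with $\|x\|=1$ and $\|f\|=|f(x)|$. For every $\varepsilon>0$ there is a norm $p_\varepsilon$ on $c_0$ such that: (i) $p_\varepsilon$ is $\varepsilon$-equivalent to $\|\cdot\|_\infty$, that is, there are $m,M>0$ with $M/m\le 1+\varepsilon$ and $m\|x\|_\infty\le p_\varepsilon(x)\le M\|x\|_\infty$ for all $x\in c_0$; (ii) $X_\varepsilon=(c_0,p_\varepsilon)$ is a Banach space, and for every two-dimensional subspace $Z$ of $X_\varepsilon^*$ the set $Z\cap\operatorname{NA}(X_\varepsilon,\mathbb R)$ is contained in the union of two one-dimensional subspaces, and the intersection of the unit sphere $S_Z$ of $Z$ with $\operatorname{NA}(X_\varepsilon,\mathbb R)$ contains at most four points; (iii) if $f,g\in\operatorname{NA}(X_\varepsilon,\mathbb R)$ are linearly independent, then $tf+(1-t)g\notin\operatorname{NA}(X_\varepsilon,\mathbb R)$ for every $0<t<1$. -/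

import Mathlib

open scoped ZeroAtInfty

/-- A norm on a real vector space `E` (as a function, bundled with its laws): a seminorm which
vanishes only at the origin. -/
structure VectorNorm (E : Type*) [AddCommGroup E] [Module ℝ E] extends Seminorm ℝ E where
  eq_zero_of_norm_eq_zero : ∀ x : E, toSeminorm x = 0 → x = 0

/-- The space `(E, p)`: the real vector space `E` normed by `p`. It is a type synonym, so that no
norm or topology which `E` may carry already is inherited. -/
def Renormed {E : Type*} [AddCommGroup E] [Module ℝ E] (_p : VectorNorm E) : Type _ := E

namespace Renormed

variable {E : Type*} [AddCommGroup E] [Module ℝ E] (p : VectorNorm E)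

instance : AddCommGroup (Renormed p) := inferInstanceAs (AddCommGroup E)

instance : Module ℝ (Renormed p) := inferInstanceAs (Module ℝ E)

/-- The identity map of `E`, as a linear bijection from `E` onto `(E, p)`. -/
def of : E ≃ₗ[ℝ] Renormed p := LinearEquiv.refl ℝ E

/-- The norm of `(E, p)` is `p`; metric and topology are the ones induced by this norm. -/
noncomputable instance : NormedAddCommGroup (Renormed p) :=
  AddGroupNorm.toNormedAddCommGroup
    { toFun := fun x => p.toSeminorm ((of p).symm x)
      map_zero' := by simp
      add_le' := fun x y => by rw [map_add]; exact map_add_le_add p.toSeminorm _ _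
      neg' := fun x => by rw [map_neg]; exact map_neg_eq_map p.toSeminorm _
      eq_zero_of_map_eq_zero' := fun x hx => by
        have := p.eq_zero_of_norm_eq_zero _ hx
        simpa using this }

theorem norm_of (x : E) : ‖of p x‖ = p.toSeminorm x := rfl

noncomputable instance : NormedSpace ℝ (Renormed p) where
  norm_smul_le a x := by
    change p.toSeminorm ((of p).symm (a • x)) ≤ ‖a‖ * p.toSeminorm ((of p).symm x)
    rw [map_smul, map_smul_eq_mul]

end Renormed

/-- A norm `p` on a normed space `E` is `ε`-equivalent to the given norm of `E`. -/
def EpsEquivalent {E : Type*} [NormedAddCommGroup E] [NormedSpace ℝ E]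
    (ε : ℝ) (p : VectorNorm E) : Prop :=
  ∃ m M : ℝ, 0 < m ∧ 0 < M ∧ M / m ≤ 1 + ε ∧
    ∀ x : E, m * ‖x‖ ≤ p.toSeminorm x ∧ p.toSeminorm x ≤ M * ‖x‖

/-- `NA(X, ℝ)`: the set of the bounded linear functionals on `X` which attain their dual norm at a
point of the unit sphere of `X`. -/
def NormAttaining (X : Type*) [NormedAddCommGroup X] [NormedSpace ℝ X] :
    Set (StrongDual ℝ X) :=
  {f | ∃ x : X, ‖x‖ = 1 ∧ ‖f‖ = |f x|}

/-! The new unit ball is `{Φ ≤ 1}`. Here `Φ` adds flat wells in the coordinates, which keep the ball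
between the sup-norm balls of radii `1` and `1 + ε`, to a small weighted sum of squares and fourth
powers of functionals `testFun k`. Since `Φ` has a gradient `D`, a functional attaining its norm at
`x` is a multiple of `D x` (`eq_smul_of_attains`). Everything follows once no combination, with
nonzero coefficients, of two independent norm attaining functionals is norm attaining.

Such a combination would give `l₃ D x₃ = l₁ D x₁ + l₂ D x₂`. On far unit vectors the wells
contribute nothing, because the points lie in `c₀`, and the perturbations inside the test
functionals force the relation for the coefficient of each `testFun k` separately
(`eq_zero_of_tsum_testFun`). Each `u = (x ↦ x m + r x n)`, `r ∈ {-1, 0, 1}`, is a limit of test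
functionals, once with squares and once with fourth powers. In the limit `l₃ u(x₃) = l₁ u(x₁) + l₂
u(x₂)`, and the same holds with the values of `u` cubed. Eliminating `u(x₃)` leaves a cubic identity
that makes `x₁` and `x₂` parallel (`cross_eq_of_cubic`). Both functionals are then multiples of the
gradient at one point, against independence. -/

open Filter Topology Metric

/-! ### Norms whose unit ball is a smooth convex body -/

/-- `D` is a gradient of the convex even function `Φ`, with a quadratic upper estimate along
segments, and the sublevel set `{Φ ≤ 1}` lies between the balls of radii `1` and `R`. -/
structure IsSmoothBody {E : Type*} [NormedAddCommGroup E] [NormedSpace ℝ E]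
    (R : ℝ) (Φ : E → ℝ) (D : E → E →ₗ[ℝ] ℝ) : Prop where
  map_zero : Φ 0 = 0
  map_neg : ∀ x, Φ (-x) = Φ x
  lower : ∀ x h, Φ x + D x h ≤ Φ (x + h)
  upper : ∀ x h, ∃ C : ℝ, ∀ t : ℝ, 0 ≤ t → t ≤ 1 → Φ (x + t • h) ≤ Φ x + t * D x h + C * t ^ 2
  le_one : ∀ x, ‖x‖ ≤ 1 → Φ x ≤ 1
  norm_le : ∀ x, Φ x ≤ 1 → ‖x‖ ≤ R

namespace IsSmoothBody

variable {E : Type*} [NormedAddCommGroup E] [NormedSpace ℝ E]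
  {R : ℝ} {Φ : E → ℝ} {D : E → E →ₗ[ℝ] ℝ}

/-- Averaging the supporting inequalities at the convex combination cancels the linear terms. -/
theorem convex (H : IsSmoothBody R Φ D) : Convex ℝ {x | Φ x ≤ 1} := by
  intro x hx y hy a b ha hb hab
  have h1 := H.lower (a • x + b • y) (x - (a • x + b • y))
  have h2 := H.lower (a • x + b • y) (y - (a • x + b • y))
  simp only [add_sub_cancel] at h1 h2
  have h3 : a * D (a • x + b • y) (x - (a • x + b • y))
      + b * D (a • x + b • y) (y - (a • x + b • y)) = 0 := by
    rw [← smul_eq_mul, ← smul_eq_mul, ← map_smul, ← map_smul, ← map_add]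
    have : a • (x - (a • x + b • y)) + b • (y - (a • x + b • y)) = 0 := by
      obtain rfl : b = 1 - a := by linarith
      module
    rw [this, _root_.map_zero]
  simp only [Set.mem_ofPred_eq] at hx hy ⊢
  have h4 := mul_le_mul_of_nonneg_left (h1.trans hx) ha
  have h5 := mul_le_mul_of_nonneg_left (h2.trans hy) hb
  have h6 : (a + b) * Φ (a • x + b • y) = Φ (a • x + b • y) := by rw [hab, one_mul]
  linarith

theorem balanced (H : IsSmoothBody R Φ D) : Balanced ℝ {x | Φ x ≤ 1} :=
  (balanced_iff_neg_mem H.convex).2 fun x hx => by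
    simpa only [Set.mem_ofPred_eq, H.map_neg] using hx

theorem closedBall_subset (H : IsSmoothBody R Φ D) : closedBall (0 : E) 1 ⊆ {x | Φ x ≤ 1} :=
  fun x hx => H.le_one x (by simpa using hx)

theorem absorbent (H : IsSmoothBody R Φ D) : Absorbent ℝ {x | Φ x ≤ 1} :=
  absorbent_nhds_zero (mem_of_superset (closedBall_mem_nhds 0 one_pos) H.closedBall_subset)

theorem gauge_le_norm (H : IsSmoothBody R Φ D) (x : E) : gauge {x | Φ x ≤ 1} x ≤ ‖x‖ := by
  simpa using mul_gauge_le_norm (x := x) (ball_subset_closedBall.trans H.closedBall_subset)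

theorem norm_le_gauge (H : IsSmoothBody R Φ D) (hR : 0 < R) (x : E) :
    ‖x‖ / R ≤ gauge {x | Φ x ≤ 1} x :=
  le_gauge_of_subset_closedBall H.absorbent hR.le
    fun x hx => by simpa using H.norm_le x hx

/-- The Minkowski functional of `{Φ ≤ 1}` as a norm. -/
noncomputable def norm (H : IsSmoothBody R Φ D) (hR : 0 < R) : VectorNorm E where
  __ := gaugeSeminorm H.balanced H.convex H.absorbent
  eq_zero_of_norm_eq_zero x hx := by
    have h1 := H.norm_le_gauge hR x
    have h2 : gauge {x | Φ x ≤ 1} x = 0 := hx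
    rw [h2, div_le_iff₀ hR, zero_mul] at h1
    exact norm_le_zero_iff.1 h1

theorem epsEquivalent (H : IsSmoothBody R Φ D) (hR : 0 < R) {ε : ℝ} (h : R ≤ 1 + ε) :
    EpsEquivalent ε (H.norm hR) := by
  refine ⟨R⁻¹, 1, by positivity, one_pos, by simpa using h, fun x => ⟨?_, ?_⟩⟩
  · have := H.norm_le_gauge hR x
    rwa [div_eq_inv_mul] at this
  · rw [one_mul]
    exact H.gauge_le_norm x

theorem completeSpace (H : IsSmoothBody R Φ D) (hR : 0 < R) [CompleteSpace E] :
    CompleteSpace (Renormed (H.norm hR)) := by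
  let e : E ≃L[ℝ] Renormed (H.norm hR) :=
    (Renormed.of (H.norm hR)).toContinuousLinearEquivOfBounds 1 R
      (fun x => by rw [one_mul]; exact H.gauge_le_norm x)
      (fun x => by
        have := H.norm_le_gauge hR ((Renormed.of (H.norm hR)).symm x)
        rw [div_le_iff₀ hR, mul_comm] at this
        exact this)
  exact (completeSpace_congr (e := e.toEquiv) e.isUniformEmbedding).1 inferInstance

/-- The points `(1 - t) • x` lie in the body, and the supporting inequality at `x` bounds `Φ x` by
`1 + t * D x x`; let `t` tend to `0`. No continuity of `Φ` is needed. -/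
theorem le_one_of_gauge_le_one (H : IsSmoothBody R Φ D) {x : E}
    (hx : gauge {x | Φ x ≤ 1} x ≤ 1) : Φ x ≤ 1 := by
  have key : ∀ t : ℝ, 0 < t → t < 1 → Φ x ≤ 1 + t * D x x := by
    intro t ht0 ht1
    have hlt : gauge {x | Φ x ≤ 1} ((1 - t) • x) < 1 := by
      rw [gauge_smul_of_nonneg (by linarith), smul_eq_mul]
      nlinarith [gauge_nonneg (s := {x | Φ x ≤ 1}) x]
    have hm := setOfPred_gauge_lt_one_subset_self H.convex (by simp [H.map_zero]) H.absorbent hlt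
    have h1 := H.lower x (-(t • x))
    rw [_root_.map_neg, map_smul, smul_eq_mul] at h1
    have h2 : x + -(t • x) = (1 - t) • x := by module
    rw [h2] at h1
    have h3 : Φ ((1 - t) • x) ≤ 1 := hm
    linarith
  by_contra! hlt
  rcases le_or_gt (D x x) 0 with hD | hD
  · have := key (1 / 2) (by norm_num) (by norm_num)
    linarith
  · have hpos : 0 < (Φ x - 1) / (2 * D x x) := div_pos (by linarith) (by positivity)
    have h1 := key (min (1 / 2) ((Φ x - 1) / (2 * D x x))) (lt_min (by norm_num) hpos)
      (lt_of_le_of_lt (min_le_left _ _) (by norm_num))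
    have h2 : min (1 / 2) ((Φ x - 1) / (2 * D x x)) * D x x ≤ (Φ x - 1) / (2 * D x x) * D x x :=
      mul_le_mul_of_nonneg_right (min_le_right _ _) hD.le
    have h3 : (Φ x - 1) / (2 * D x x) * D x x = (Φ x - 1) / 2 := by field_simp
    linarith

/-- Where the derivative is negative, the function decreases for a short time. -/
theorem exists_le_of_neg (H : IsSmoothBody R Φ D) {x h : E} (hx : Φ x ≤ 1)
    (hh : D x h < 0 ∨ Φ x < 1) : ∃ t : ℝ, 0 < t ∧ Φ (x + t • h) ≤ 1 := by
  obtain ⟨C, hC⟩ := H.upper x h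
  have hev : ∀ᶠ t : ℝ in 𝓝[>] 0, Φ x + t * D x h + C * t ^ 2 ≤ 1 := by
    rcases hh with hh | hh
    · have h1 : Tendsto (fun t : ℝ => D x h + C * t) (𝓝[>] 0) (𝓝 (D x h)) := by
        have : Continuous fun t : ℝ => D x h + C * t := by fun_prop
        simpa using (this.tendsto 0).mono_left nhdsWithin_le_nhds
      filter_upwards [h1.eventually (gt_mem_nhds hh), self_mem_nhdsWithin] with t ht ht0
      have : t * (D x h + C * t) ≤ 0 := mul_nonpos_of_nonneg_of_nonpos (le_of_lt ht0) ht.le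
      nlinarith
    · have h1 : Tendsto (fun t : ℝ => Φ x + t * D x h + C * t ^ 2) (𝓝[>] 0) (𝓝 (Φ x)) := by
        have : Continuous fun t : ℝ => Φ x + t * D x h + C * t ^ 2 := by fun_prop
        simpa using (this.tendsto 0).mono_left nhdsWithin_le_nhds
      filter_upwards [h1.eventually (gt_mem_nhds hh)] with t ht using ht.le
  have hle : ∀ᶠ t : ℝ in 𝓝[>] 0, t ≤ 1 :=
    nhdsWithin_le_nhds (eventually_le_nhds one_pos)
  obtain ⟨t, ht1, ht2, ht0⟩ := (hev.and (hle.and self_mem_nhdsWithin)).exists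
  exact ⟨t, ht0, (hC t (le_of_lt ht0) ht2).trans ht1⟩

/-- If `Φ x < 1`, a short move outwards along `x` would stay in the body, although the gauge exceeds
`1` there. So `Φ x = 1`, and comparison with `Φ 0 = 0` gives `D x x ≥ 1`. -/
theorem apply_self_pos (H : IsSmoothBody R Φ D) {x : E}
    (hx : gauge {x | Φ x ≤ 1} x = 1) : 0 < D x x := by
  have h1 : Φ x ≤ 1 := H.le_one_of_gauge_le_one hx.le
  have h2 : ¬ Φ x < 1 := fun hlt => by
    obtain ⟨t, ht, hle⟩ := H.exists_le_of_neg (h := x) h1 (Or.inr hlt)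
    have h3 : gauge {x | Φ x ≤ 1} (x + t • x) ≤ 1 := gauge_le_one_of_mem hle
    rw [show x + t • x = (1 + t) • x by module, gauge_smul_of_nonneg (by linarith), hx] at h3
    simp only [smul_eq_mul] at h3
    linarith
  have h4 := H.lower x (-x)
  rw [add_neg_cancel, H.map_zero, _root_.map_neg] at h4
  linarith

/-- A functional which attains its norm at `x` is a multiple of the gradient at `x`. -/
theorem eq_smul_of_attains (H : IsSmoothBody R Φ D) (hR : 0 < R)
    (f : StrongDual ℝ (Renormed (H.norm hR))) {x : Renormed (H.norm hR)} (hx : ‖x‖ = 1)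
    (hf : ‖f‖ = |f x|) (h : E) :
    f (Renormed.of _ h) = f x / D ((Renormed.of _).symm x) ((Renormed.of _).symm x)
      * D ((Renormed.of _).symm x) h := by
  obtain ⟨y, rfl⟩ := (Renormed.of (H.norm hR)).surjective x
  simp only [LinearEquiv.symm_apply_apply]
  have hy : gauge {x | Φ x ≤ 1} y = 1 := hx
  have hpos := H.apply_self_pos hy
  suffices key : ∀ f : StrongDual ℝ (Renormed (H.norm hR)), ‖f‖ = f (Renormed.of _ y) →
      ∀ h, D y h < 0 → f (Renormed.of _ h) ≤ 0 by
    have key2 : ∀ f : StrongDual ℝ (Renormed (H.norm hR)), ‖f‖ = f (Renormed.of _ y) →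
        ∀ h, f (Renormed.of _ h) ≤ f (Renormed.of _ y) / D y y * D y h := by
      intro f hf h
      refine le_of_forall_pos_le_add fun δ hδ => ?_
      have h0 : 0 ≤ f (Renormed.of _ y) := hf ▸ norm_nonneg f
      set F := f (Renormed.of _ y)
      have hs : 0 < δ / (F + 1) := by positivity
      -- The multiple of `y` cancels `D y h`, and the extra `δ / (F + 1)` makes the derivative
      -- strictly negative at a cost of at most `δ` in the value of `f`.
      have h1 := key f hf (h - ((D y h) / D y y + δ / (F + 1)) • y) (by
        rw [map_sub, map_smul, smul_eq_mul, add_mul, div_mul_cancel₀ _ hpos.ne']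
        have := mul_pos hs hpos
        linarith)
      rw [map_sub, map_sub, map_smul, map_smul, smul_eq_mul] at h1
      have h2 : δ / (F + 1) * F ≤ δ := by
        rw [div_mul_eq_mul_div, div_le_iff₀ (by positivity)]
        nlinarith
      have h3 : F / D y y * D y h = D y h / D y y * F := by ring
      rw [h3]
      change f (Renormed.of _ h) - (D y h / D y y + δ / (F + 1)) * F ≤ 0 at h1
      linarith
    have key3 : ∀ f : StrongDual ℝ (Renormed (H.norm hR)), ‖f‖ = f (Renormed.of _ y) →
        ∀ h, f (Renormed.of _ h) = f (Renormed.of _ y) / D y y * D y h := by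
      intro f hf h
      refine le_antisymm (key2 f hf h) ?_
      have := key2 f hf (-h)
      rw [_root_.map_neg, _root_.map_neg, _root_.map_neg] at this
      linarith
    rcases le_total 0 (f (Renormed.of _ y)) with h0 | h0
    · exact key3 f (by rw [hf, abs_of_nonneg h0]) h
    · have := key3 (-f) (by rw [norm_neg, hf, abs_of_nonpos h0]; rfl) h
      simp only [neg_apply] at this
      rw [neg_div, neg_mul] at this
      linarith
  intro f hf h hh
  -- A short step along `h` stays in the unit ball, where `f` is at most `‖f‖ = f y`.
  obtain ⟨t, ht, hle⟩ := H.exists_le_of_neg (H.le_one_of_gauge_le_one hy.le) (Or.inl hh)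
  have h1 : ‖Renormed.of (H.norm hR) (y + t • h)‖ ≤ 1 := gauge_le_one_of_mem hle
  have h2 := (le_abs_self _).trans (f.le_of_opNorm_le_of_le le_rfl h1)
  rw [mul_one, hf, map_add, map_add, map_smul, map_smul, smul_eq_mul] at h2
  have : t * f (Renormed.of _ h) ≤ 0 := by linarith
  exact nonpos_of_mul_nonpos_right this ht

end IsSmoothBody

/-! ### Termwise gradients of sums of convex functions -/

/-- A pointwise convergent sum of convex functions of linear functionals, with the data needed to
differentiate it term by term. -/
structure IsGradientSum {E ι : Type*} [AddCommGroup E] [Module ℝ E]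
    (θ θ' : ι → ℝ → ℝ) (v : ι → E →ₗ[ℝ] ℝ) : Prop where
  lower : ∀ i s u, θ i s + θ' i s * u ≤ θ i (s + u)
  summable : ∀ x, Summable fun i => θ i (v i x)
  summable_deriv : ∀ x h, Summable fun i => θ' i (v i x) * v i h
  upper : ∀ x h, ∃ C : ι → ℝ, Summable C ∧ ∀ t : ℝ, 0 ≤ t → t ≤ 1 → ∀ i,
    θ i (v i x + t * v i h) ≤ θ i (v i x) + t * (θ' i (v i x) * v i h) + C i * t ^ 2

namespace IsGradientSum

variable {E ι : Type*} [AddCommGroup E] [Module ℝ E]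
  {θ θ' : ι → ℝ → ℝ} {v : ι → E →ₗ[ℝ] ℝ}

/-- The gradient of the sum. -/
noncomputable def grad (H : IsGradientSum θ θ' v) (x : E) : E →ₗ[ℝ] ℝ where
  toFun h := ∑' i, θ' i (v i x) * v i h
  map_add' h k := by
    rw [← (H.summable_deriv x h).tsum_add (H.summable_deriv x k)]
    simp only [map_add, mul_add]
  map_smul' a h := by
    simp only [map_smul, smul_eq_mul, RingHom.id_apply]
    rw [← tsum_mul_left]
    exact tsum_congr fun i => by ring

theorem grad_apply (H : IsGradientSum θ θ' v) (x h : E) :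
    H.grad x h = ∑' i, θ' i (v i x) * v i h := rfl

theorem tsum_lower (H : IsGradientSum θ θ' v) (x h : E) :
    ∑' i, θ i (v i x) + H.grad x h ≤ ∑' i, θ i (v i (x + h)) := by
  rw [grad_apply, ← (H.summable x).tsum_add (H.summable_deriv x h)]
  refine ((H.summable x).add (H.summable_deriv x h)).tsum_le_tsum (fun i => ?_) (H.summable _)
  rw [map_add]
  exact H.lower _ _ _

theorem tsum_upper (H : IsGradientSum θ θ' v) (x h : E) : ∃ C : ℝ, ∀ t : ℝ, 0 ≤ t → t ≤ 1 →
    ∑' i, θ i (v i (x + t • h)) ≤ ∑' i, θ i (v i x) + t * H.grad x h + C * t ^ 2 := by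
  obtain ⟨C, hC, hle⟩ := H.upper x h
  refine ⟨∑' i, C i, fun t h0 h1 => ?_⟩
  have hs := (H.summable_deriv x h).mul_left t
  rw [grad_apply, ← tsum_mul_left, ← tsum_mul_right, ← (H.summable x).tsum_add hs,
    ← ((H.summable x).add hs).tsum_add (hC.mul_right _)]
  refine (H.summable _).tsum_le_tsum (fun i => ?_) (((H.summable x).add hs).add (hC.mul_right _))
  rw [map_add, map_smul, smul_eq_mul]
  exact hle t h0 h1 i

end IsGradientSum

/-! ### Flat wells in the coordinates of `c₀` -/

theorem ZeroAtInftyContinuousMap.abs_apply_le (x : C₀(ℕ, ℝ)) (n : ℕ) : |x n| ≤ ‖x‖ :=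
  x.toBCF.norm_coe_le_norm n

theorem ZeroAtInftyContinuousMap.norm_le_of_abs_apply_le {x : C₀(ℕ, ℝ)} {R : ℝ} (hR : 0 ≤ R)
    (h : ∀ n, |x n| ≤ R) : ‖x‖ ≤ R := by
  rw [← ZeroAtInftyContinuousMap.norm_toBCF_eq_norm]
  exact (BoundedContinuousFunction.norm_le hR).2 h

theorem ZeroAtInftyContinuousMap.finite_lt_abs (x : C₀(ℕ, ℝ)) {δ : ℝ} (hδ : 0 < δ) :
    {n | δ < |x n|}.Finite := by
  have h1 : Tendsto (fun n => |x n|) cofinite (𝓝 0) := by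
    have := (zero_at_infty x).abs
    rwa [cocompact_eq_cofinite, abs_zero] at this
  have h2 := h1.eventually (ge_mem_nhds hδ)
  simpa [Filter.eventually_cofinite] using h2

/-- Evaluation at `n`. -/
def coordEval (n : ℕ) : C₀(ℕ, ℝ) →ₗ[ℝ] ℝ where
  toFun x := x n
  map_add' _ _ := rfl
  map_smul' _ _ := rfl

theorem coordEval_apply (n : ℕ) (x : C₀(ℕ, ℝ)) : coordEval n x = x n := rfl

/-- A convex `C¹` function which vanishes exactly on `[-1, 1]`. -/
noncomputable def flatWell (A s : ℝ) : ℝ := A * (max (s - 1) 0 ^ 2 + max (-s - 1) 0 ^ 2)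

/-- The derivative of `flatWell`. -/
noncomputable def flatWellDeriv (A s : ℝ) : ℝ := A * (2 * (max (s - 1) 0 - max (-s - 1) 0))

theorem max_zero_sq_lower (s u : ℝ) : max s 0 ^ 2 + 2 * max s 0 * u ≤ max (s + u) 0 ^ 2 := by
  rcases le_total s 0 with h | h <;> rcases le_total (s + u) 0 with h' | h' <;>
    simp only [max_eq_left, max_eq_right, h, h'] <;> nlinarith [sq_nonneg u]

theorem max_zero_sq_upper (s u : ℝ) :
    max (s + u) 0 ^ 2 ≤ max s 0 ^ 2 + 2 * max s 0 * u + u ^ 2 := by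
  rcases le_total s 0 with h | h <;> rcases le_total (s + u) 0 with h' | h' <;>
    simp only [max_eq_left, max_eq_right, h, h'] <;> nlinarith [sq_nonneg (s + u)]

theorem flatWell_lower {A : ℝ} (hA : 0 ≤ A) (s u : ℝ) :
    flatWell A s + flatWellDeriv A s * u ≤ flatWell A (s + u) := by
  have h1 := max_zero_sq_lower (s - 1) u
  have h2 := max_zero_sq_lower (-s - 1) (-u)
  rw [show s - 1 + u = s + u - 1 by ring] at h1
  rw [show -s - 1 + -u = -(s + u) - 1 by ring] at h2
  have h3 := mul_le_mul_of_nonneg_left (add_le_add h1 h2) hA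
  unfold flatWell flatWellDeriv
  linarith

theorem flatWell_upper {A : ℝ} (hA : 0 ≤ A) (s u : ℝ) :
    flatWell A (s + u) ≤ flatWell A s + flatWellDeriv A s * u + 2 * A * u ^ 2 := by
  have h1 := max_zero_sq_upper (s - 1) u
  have h2 := max_zero_sq_upper (-s - 1) (-u)
  rw [show s - 1 + u = s + u - 1 by ring] at h1
  rw [show -s - 1 + -u = -(s + u) - 1 by ring] at h2
  have h3 := mul_le_mul_of_nonneg_left (add_le_add h1 h2) hA
  unfold flatWell flatWellDeriv
  linarith

theorem flatWell_nonneg {A : ℝ} (hA : 0 ≤ A) (s : ℝ) : 0 ≤ flatWell A s := by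
  unfold flatWell
  positivity

theorem flatWell_neg (A s : ℝ) : flatWell A (-s) = flatWell A s := by
  unfold flatWell
  rw [neg_neg, add_comm]

theorem flatWell_eq_zero (A : ℝ) {s : ℝ} (hs : |s| ≤ 1) : flatWell A s = 0 := by
  rw [abs_le] at hs
  simp [flatWell, max_eq_right (show s - 1 ≤ 0 by linarith),
    max_eq_right (show -s - 1 ≤ 0 by linarith)]

theorem flatWellDeriv_eq_zero (A : ℝ) {s : ℝ} (hs : |s| ≤ 1) : flatWellDeriv A s = 0 := by
  rw [abs_le] at hs
  simp [flatWellDeriv, max_eq_right (show s - 1 ≤ 0 by linarith),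
    max_eq_right (show -s - 1 ≤ 0 by linarith)]

theorem le_flatWell {A : ℝ} (hA : 0 ≤ A) {s : ℝ} (hs : 1 ≤ |s|) :
    A * (|s| - 1) ^ 2 ≤ flatWell A s := by
  refine mul_le_mul_of_nonneg_left ?_ hA
  rcases abs_cases s with ⟨h, -⟩ | ⟨h, -⟩ <;> rw [h] at hs ⊢
  · rw [max_eq_left (show 0 ≤ s - 1 by linarith)]
    nlinarith [sq_nonneg (max (-s - 1) 0)]
  · rw [max_eq_left (show 0 ≤ -s - 1 by linarith)]
    nlinarith [sq_nonneg (max (s - 1) 0)]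

/-- Only finitely many coordinates of a point of `c₀` leave `[-1, 1]`, so the sums are finite. -/
theorem isGradientSum_flatWell {A : ℝ} (hA : 0 ≤ A) :
    IsGradientSum (fun _ : ℕ => flatWell A) (fun _ => flatWellDeriv A) coordEval where
  lower _ := flatWell_lower hA
  summable x := summable_of_hasFiniteSupport <| (x.finite_lt_abs one_pos).subset fun n hn => by
    by_contra hlt
    exact hn (flatWell_eq_zero A (not_lt.1 hlt))
  summable_deriv x h := summable_of_hasFiniteSupport <|
    (x.finite_lt_abs one_pos).subset fun n hn => by
      by_contra hlt
      refine hn ?_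
      simp only [coordEval_apply]
      rw [flatWellDeriv_eq_zero A (not_lt.1 hlt), zero_mul]
  upper x h := by
    classical
    -- Off this finite set `|x n|` and `|h n|` are at most `1 / 2`, so the whole segment stays in
    -- the flat part of the well.
    have hfin := (x.finite_lt_abs (half_pos one_pos)).union (h.finite_lt_abs (half_pos one_pos))
    refine ⟨fun n => if n ∈ {n | 1 / 2 < |x n|} ∪ {n | 1 / 2 < |h n|} then 2 * A * h n ^ 2 else 0,
      summable_of_hasFiniteSupport (hfin.subset fun n hn => ?_), fun t h0 h1 n => ?_⟩
    · by_contra hlt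
      exact hn (if_neg hlt)
    · simp only [coordEval_apply]
      split_ifs with hn
      · have := flatWell_upper hA (x n) (t * h n)
        linarith
      · simp only [Set.mem_union, Set.mem_ofPred_eq, not_or, not_lt] at hn
        have h2 : |t * h n| ≤ 1 / 2 := by
          rw [abs_mul, abs_of_nonneg h0]
          nlinarith [hn.2, abs_nonneg (h n)]
        rw [flatWell_eq_zero, flatWell_eq_zero, flatWellDeriv_eq_zero]
        · simp
        · linarith [hn.1]
        · linarith [hn.1]
        · exact (abs_add_le _ _).trans (by linarith [hn.1])

/-! ### Weighted sums of squares and fourth powers -/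

/-- The square or the fourth power. -/
noncomputable def evenPow (b : Prop) [Decidable b] (s : ℝ) : ℝ := if b then s ^ 4 else s ^ 2

/-- The derivative of `evenPow`. -/
noncomputable def evenPowDeriv (b : Prop) [Decidable b] (s : ℝ) : ℝ :=
  if b then 4 * s ^ 3 else 2 * s

section evenPow

variable (b : Prop) [Decidable b]

theorem evenPow_lower (s u : ℝ) : evenPow b s + evenPowDeriv b s * u ≤ evenPow b (s + u) := by
  unfold evenPow evenPowDeriv
  split_ifs
  · nlinarith [mul_nonneg (sq_nonneg u) (sq_nonneg (2 * s + u)), sq_nonneg (u * s)]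
  · nlinarith [sq_nonneg u]

theorem evenPow_neg (s : ℝ) : evenPow b (-s) = evenPow b s := by
  unfold evenPow
  split_ifs <;> ring

theorem evenPow_nonneg (s : ℝ) : 0 ≤ evenPow b s := by
  unfold evenPow
  split_ifs <;> positivity

theorem evenPow_zero : evenPow b 0 = 0 := by
  simp [evenPow]

variable {B s : ℝ}

theorem evenPow_le (hB : 1 ≤ B) (hs : |s| ≤ B) : evenPow b s ≤ B ^ 4 := by
  have h4 : s ^ 4 ≤ B ^ 4 := by
    rw [← (show Even 4 by decide).pow_abs s]
    gcongr
  have h2 : s ^ 2 ≤ B ^ 2 := by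
    rw [← sq_abs s]
    gcongr
  unfold evenPow
  split_ifs
  · exact h4
  · exact h2.trans (pow_le_pow_right₀ hB (by norm_num))

theorem abs_evenPowDeriv_le (hB : 1 ≤ B) (hs : |s| ≤ B) : |evenPowDeriv b s| ≤ 4 * B ^ 3 := by
  unfold evenPowDeriv
  split_ifs
  · rw [abs_mul, abs_pow, abs_of_nonneg (by norm_num : (0 : ℝ) ≤ 4)]
    gcongr
  · rw [abs_mul, abs_of_nonneg (by norm_num : (0 : ℝ) ≤ 2)]
    have : B ≤ B ^ 3 := le_self_pow₀ hB (by norm_num)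
    linarith

theorem evenPow_upper (hB : 1 ≤ B) (hs : |s| ≤ B) {u t : ℝ} (hu : |u| ≤ B) (h0 : 0 ≤ t)
    (h1 : t ≤ 1) :
    evenPow b (s + t * u) ≤ evenPow b s + t * (evenPowDeriv b s * u) + 11 * B ^ 4 * t ^ 2 := by
  have hs2 : s ^ 2 ≤ B ^ 2 := sq_le_sq' (by linarith [neg_le_of_abs_le hs]) (le_of_abs_le hs)
  have hu2 : u ^ 2 ≤ B ^ 2 := sq_le_sq' (by linarith [neg_le_of_abs_le hu]) (le_of_abs_le hu)
  unfold evenPow evenPowDeriv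
  split_ifs
  · have e1 : s ^ 2 * u ^ 2 ≤ B ^ 2 * B ^ 2 := by gcongr
    have e2 : t * (s * u ^ 3) ≤ B ^ 4 := by
      refine (le_abs_self _).trans ?_
      rw [abs_mul, abs_mul, abs_pow, abs_of_nonneg h0]
      calc t * (|s| * |u| ^ 3) ≤ 1 * (B * B ^ 3) := by gcongr
        _ = B ^ 4 := by ring
    have e3 : t ^ 2 * (u ^ 2) ^ 2 ≤ 1 ^ 2 * (B ^ 2) ^ 2 := by gcongr
    -- The constant is `11 = 6 + 4 + 1`, the binomial coefficients of the terms of order at least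
    -- two in `t`.
    have e4 : 6 * (s ^ 2 * u ^ 2) + 4 * (t * (s * u ^ 3)) + t ^ 2 * (u ^ 2) ^ 2 ≤ 11 * B ^ 4 := by
      linarith
    have e5 := mul_le_mul_of_nonneg_right e4 (sq_nonneg t)
    linarith
  · have e1 : u ^ 2 ≤ 11 * B ^ 4 := by
      have : B ^ 2 ≤ B ^ 4 := pow_le_pow_right₀ hB (by norm_num)
      nlinarith [sq_nonneg B]
    have e5 := mul_le_mul_of_nonneg_right e1 (sq_nonneg t)
    linarith

end evenPow

/-- Geometric weights. -/
noncomputable def weight (k : ℕ) : ℝ := (1 / 16) ^ k / 1024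

theorem weight_pos (k : ℕ) : 0 < weight k := by
  unfold weight
  positivity

theorem summable_weight : Summable weight :=
  (summable_geometric_of_lt_one (by norm_num) (by norm_num)).div_const _

theorem tsum_weight_le : ∑' k, weight k ≤ 1 / 256 := by
  unfold weight
  rw [tsum_div_const, tsum_geometric_of_lt_one (by norm_num) (by norm_num)]
  norm_num

theorem isGradientSum_evenPow {E : Type*} [SeminormedAddCommGroup E] [Module ℝ E]
    (q : ℕ → Prop) [DecidablePred q] {v : ℕ → E →ₗ[ℝ] ℝ} {L : ℝ} (hL : 0 ≤ L)
    (hv : ∀ k x, |v k x| ≤ L * ‖x‖) :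
    IsGradientSum (fun k s => weight k * evenPow (q k) s)
      (fun k s => weight k * evenPowDeriv (q k) s) v where
  lower k s u := by
    have := mul_le_mul_of_nonneg_left (evenPow_lower (q k) s u) (weight_pos k).le
    linarith
  summable x := by
    have hB : 1 ≤ 1 + L * ‖x‖ := le_add_of_nonneg_right (by positivity)
    refine .of_nonneg_of_le (fun k => mul_nonneg (weight_pos k).le (evenPow_nonneg _ _))
      (fun k => ?_) (summable_weight.mul_right ((1 + L * ‖x‖) ^ 4))
    exact mul_le_mul_of_nonneg_left
      (evenPow_le _ hB ((hv k x).trans (by linarith))) (weight_pos k).le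
  summable_deriv x h := by
    have hB : 1 ≤ 1 + L * ‖x‖ := le_add_of_nonneg_right (by positivity)
    refine .of_norm_bounded (summable_weight.mul_right (4 * (1 + L * ‖x‖) ^ 3 * (L * ‖h‖)))
      fun k => ?_
    rw [Real.norm_eq_abs, abs_mul, abs_mul, abs_of_pos (weight_pos k), mul_assoc]
    have := abs_evenPowDeriv_le (q k) hB ((hv k x).trans (by linarith))
    have h2 := hv k h
    have := weight_pos k
    gcongr
  upper x h := by
    set B := 1 + L * ‖x‖ + L * ‖h‖
    have hx : 0 ≤ L * ‖x‖ := by positivity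
    have hh : 0 ≤ L * ‖h‖ := by positivity
    have hB : 1 ≤ B := by linarith
    refine ⟨fun k => weight k * (11 * B ^ 4), summable_weight.mul_right _, fun t h0 h1 k => ?_⟩
    have := mul_le_mul_of_nonneg_left (evenPow_upper (q k) hB ((hv k x).trans (by linarith))
      ((hv k h).trans (by linarith)) h0 h1) (weight_pos k).le
    linarith

/-! ### Coded functionals and their perturbations -/

/-- The first coordinate of the functional coded by `c`. -/
def codeFst (c : ℕ) : ℕ := c.unpair.1.unpair.1

/-- The second coordinate of the functional coded by `c`. -/
def codeSnd (c : ℕ) : ℕ := c.unpair.1.unpair.2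

/-- The coefficient, `-1`, `0` or `1`, of the second coordinate. -/
def codeCoeff (c : ℕ) : ℝ := ((c.unpair.2 % 3 : ℕ) : ℝ) - 1

/-- The parity coded by `c`. -/
def codeParity (c : ℕ) : Prop := c.unpair.2 % 2 = 1

instance : DecidablePred codeParity := fun _ => inferInstanceAs (Decidable (_ = _))

theorem abs_codeCoeff_le (c : ℕ) : |codeCoeff c| ≤ 1 := by
  unfold codeCoeff
  have h : c.unpair.2 % 3 ≤ 2 := Nat.le_of_lt_succ (Nat.mod_lt _ (by norm_num))
  have h' : ((c.unpair.2 % 3 : ℕ) : ℝ) ≤ 2 := by exact_mod_cast h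
  rw [abs_le]
  constructor <;> linarith [Nat.cast_nonneg (α := ℝ) (c.unpair.2 % 3)]

/-- The functional `x ↦ x m + r x n` coded by `c`. -/
noncomputable def codeFun (c : ℕ) : C₀(ℕ, ℝ) →ₗ[ℝ] ℝ :=
  coordEval (codeFst c) + codeCoeff c • coordEval (codeSnd c)

theorem codeFun_apply (c : ℕ) (x : C₀(ℕ, ℝ)) :
    codeFun c x = x (codeFst c) + codeCoeff c * x (codeSnd c) := rfl

theorem abs_codeFun_le (c : ℕ) (x : C₀(ℕ, ℝ)) : |codeFun c x| ≤ 2 * ‖x‖ := by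
  rw [codeFun_apply]
  refine (abs_add_le _ _).trans ?_
  rw [abs_mul]
  have := mul_le_mul (abs_codeCoeff_le c) (x.abs_apply_le (codeSnd c)) (abs_nonneg _) zero_le_one
  linarith [x.abs_apply_le (codeFst c)]

/-- The coefficients of the perturbation of index `k`: its support is the `k`-th row of `ℕ × ℕ`. -/
noncomputable def rowCoeff (k j : ℕ) : ℝ := if j.unpair.1 = k then (1 / 4) ^ j else 0

theorem rowCoeff_nonneg (k j : ℕ) : 0 ≤ rowCoeff k j := by
  unfold rowCoeff
  split_ifs <;> positivity

theorem rowCoeff_le (k j : ℕ) : rowCoeff k j ≤ (1 / 2) ^ k * (1 / 2) ^ j := by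
  unfold rowCoeff
  split_ifs with h
  · have hk : k ≤ j := h ▸ Nat.unpair_left_le j
    rw [show (1 / 4 : ℝ) = 1 / 2 * (1 / 2) by norm_num, mul_pow]
    gcongr ?_ * _
    exact pow_le_pow_of_le_one (by norm_num) (by norm_num) hk
  · positivity

theorem summable_half : Summable fun j : ℕ => (1 / 2 : ℝ) ^ j :=
  summable_geometric_of_lt_one (by norm_num) (by norm_num)

theorem abs_rowCoeff_mul_le (k : ℕ) (x : C₀(ℕ, ℝ)) (j : ℕ) :
    ‖rowCoeff k j * x j‖ ≤ (1 / 2) ^ j * ((1 / 2) ^ k * ‖x‖) := by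
  rw [Real.norm_eq_abs, abs_mul, abs_of_nonneg (rowCoeff_nonneg k j)]
  calc rowCoeff k j * |x j| ≤ ((1 / 2) ^ k * (1 / 2) ^ j) * ‖x‖ :=
        mul_le_mul (rowCoeff_le k j) (x.abs_apply_le j) (abs_nonneg _) (by positivity)
    _ = _ := by ring

theorem summable_rowCoeff_mul (k : ℕ) (x : C₀(ℕ, ℝ)) : Summable fun j => rowCoeff k j * x j :=
  .of_norm_bounded (summable_half.mul_right _) (abs_rowCoeff_mul_le k x)

/-- The perturbation of index `k`. -/
noncomputable def rowFun (k : ℕ) : C₀(ℕ, ℝ) →ₗ[ℝ] ℝ where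
  toFun x := ∑' j, rowCoeff k j * x j
  map_add' x y := by
    rw [← (summable_rowCoeff_mul k x).tsum_add (summable_rowCoeff_mul k y)]
    simp [mul_add]
  map_smul' a x := by
    simp only [ZeroAtInftyContinuousMap.smul_apply, smul_eq_mul, RingHom.id_apply]
    rw [← tsum_mul_left]
    exact tsum_congr fun i => by ring

theorem rowFun_apply (k : ℕ) (x : C₀(ℕ, ℝ)) : rowFun k x = ∑' j, rowCoeff k j * x j := rfl

theorem abs_rowFun_le (k : ℕ) (x : C₀(ℕ, ℝ)) : |rowFun k x| ≤ 2 * ((1 / 2) ^ k * ‖x‖) := by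
  rw [rowFun_apply, ← Real.norm_eq_abs]
  refine (tsum_of_norm_bounded (summable_half.mul_right _).hasSum
    (abs_rowCoeff_mul_le k x)).trans_eq ?_
  rw [tsum_mul_right, tsum_geometric_of_lt_one (by norm_num) (by norm_num)]
  norm_num

/-- Perturbations of the coded functionals, each of which is approximated infinitely often. -/
noncomputable def testFun (k : ℕ) : C₀(ℕ, ℝ) →ₗ[ℝ] ℝ := codeFun k.unpair.1 + rowFun k

theorem testFun_apply (k : ℕ) (x : C₀(ℕ, ℝ)) :
    testFun k x = codeFun k.unpair.1 x + rowFun k x := rfl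

theorem abs_testFun_le (k : ℕ) (x : C₀(ℕ, ℝ)) : |testFun k x| ≤ 4 * ‖x‖ := by
  rw [testFun_apply]
  refine (abs_add_le _ _).trans ?_
  have h1 := abs_codeFun_le k.unpair.1 x
  have h2 := abs_rowFun_le k x
  have h3 : (1 / 2 : ℝ) ^ k * ‖x‖ ≤ 1 * ‖x‖ :=
    mul_le_mul_of_nonneg_right (pow_le_one₀ (by norm_num) (by norm_num)) (norm_nonneg x)
  linarith

/-- The indices `Nat.pair c i` share the code `c`, and their perturbations have norm at most `2 * (1
/ 2) ^ i`. -/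
theorem tendsto_testFun (c : ℕ) (x : C₀(ℕ, ℝ)) :
    Tendsto (fun i => testFun (Nat.pair c i) x) atTop (𝓝 (codeFun c x)) := by
  have h1 : Tendsto (fun i : ℕ => 2 * ((1 / 2 : ℝ) ^ i * ‖x‖)) atTop (𝓝 0) := by
    have := ((tendsto_pow_atTop_nhds_zero_of_lt_one (r := (1 / 2 : ℝ)) (by norm_num)
      (by norm_num)).mul_const ‖x‖).const_mul 2
    simpa using this
  have h2 : Tendsto (fun i => rowFun (Nat.pair c i) x) atTop (𝓝 0) := by
    refine squeeze_zero_norm (fun i => (abs_rowFun_le _ x).trans ?_) h1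
    gcongr 2 * (?_ * _)
    exact pow_le_pow_of_le_one (by norm_num) (by norm_num) (Nat.right_le_pair c i)
  simp only [testFun_apply, Nat.unpair_pair]
  simpa using h2.const_add (codeFun c x)

/-- The parity attached to the test functional of index `k`. -/
def testParity (k : ℕ) : Prop := codeParity k.unpair.1

instance : DecidablePred testParity := fun k => inferInstanceAs (Decidable (codeParity k.unpair.1))

theorem isGradientSum_testFun :
    IsGradientSum (fun k s => weight k * evenPow (testParity k) s)
      (fun k s => weight k * evenPowDeriv (testParity k) s) testFun :=
  isGradientSum_evenPow testParity (by norm_num) abs_testFun_le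

/-! ### The convex body of the new norm -/

/-- The convex function whose sublevel set is the unit ball of the new norm. -/
noncomputable def bodyFun (ε : ℝ) (x : C₀(ℕ, ℝ)) : ℝ :=
  ∑' n, flatWell (1 / ε ^ 2) (coordEval n x)
    + ∑' k, weight k * evenPow (testParity k) (testFun k x)

/-- The gradient of `bodyFun`. -/
noncomputable def bodyGrad (ε : ℝ) (x : C₀(ℕ, ℝ)) : C₀(ℕ, ℝ) →ₗ[ℝ] ℝ :=
  (isGradientSum_flatWell (by positivity : 0 ≤ 1 / ε ^ 2)).grad x + isGradientSum_testFun.grad x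

theorem bodyGrad_apply (ε : ℝ) (x h : C₀(ℕ, ℝ)) :
    bodyGrad ε x h = ∑' n, flatWellDeriv (1 / ε ^ 2) (x n) * h n
      + ∑' k, weight k * evenPowDeriv (testParity k) (testFun k x) * testFun k h := rfl

theorem isSmoothBody {ε : ℝ} (hε : 0 < ε) : IsSmoothBody (1 + ε) (bodyFun ε) (bodyGrad ε) := by
  have hA : 0 ≤ 1 / ε ^ 2 := by positivity
  have H1 := isGradientSum_flatWell hA
  have H2 := isGradientSum_testFun
  refine ⟨?_, fun x => ?_, fun x h => ?_, fun x h => ?_, fun x hx => ?_, fun x hx => ?_⟩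
  · simp [bodyFun, flatWell_eq_zero, evenPow_zero]
  · simp only [bodyFun, map_neg, flatWell_neg, evenPow_neg]
  · have h1 := H1.tsum_lower x h
    have h2 := H2.tsum_lower x h
    have e : bodyGrad ε x h = H1.grad x h + H2.grad x h := rfl
    unfold bodyFun
    linarith
  · obtain ⟨C1, h1⟩ := H1.tsum_upper x h
    obtain ⟨C2, h2⟩ := H2.tsum_upper x h
    refine ⟨C1 + C2, fun t h0 ht => ?_⟩
    have h1 := h1 t h0 ht
    have h2 := h2 t h0 ht
    have e : bodyGrad ε x h = H1.grad x h + H2.grad x h := rfl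
    unfold bodyFun
    rw [e]
    linarith
  · have h1 : ∀ n, flatWell (1 / ε ^ 2) (coordEval n x) = 0 := fun n =>
      flatWell_eq_zero _ ((x.abs_apply_le n).trans hx)
    -- On the unit ball the test functionals are at most `4`, and `4 ^ 4 = 256` matches the bound `1
    -- / 256` on the total weight.
    have h2 : ∑' k, weight k * evenPow (testParity k) (testFun k x) ≤ ∑' k, weight k * 4 ^ 4 :=
      (H2.summable x).tsum_le_tsum (fun k => mul_le_mul_of_nonneg_left
        (evenPow_le _ (by norm_num) ((abs_testFun_le k x).trans (by linarith)))
        (weight_pos k).le) (summable_weight.mul_right _)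
    rw [tsum_mul_right] at h2
    simp only [bodyFun, h1, tsum_zero, zero_add]
    linarith [tsum_weight_le]
  · refine ZeroAtInftyContinuousMap.norm_le_of_abs_apply_le (by linarith) fun n => ?_
    by_contra! hlt
    have h1 : flatWell (1 / ε ^ 2) (x n) ≤ ∑' n, flatWell (1 / ε ^ 2) (coordEval n x) :=
      (H1.summable x).le_tsum n fun m _ => flatWell_nonneg hA _
    have h2 : 0 ≤ ∑' k, weight k * evenPow (testParity k) (testFun k x) :=
      tsum_nonneg fun k => mul_nonneg (weight_pos k).le (evenPow_nonneg _ _)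
    have h3 := le_flatWell hA (s := x n) (by linarith)
    -- The factor `1 / ε ^ 2` makes a single well exceed `1` as soon as `|x n| > 1 + ε`.
    have h4 : 1 < 1 / ε ^ 2 * (|x n| - 1) ^ 2 := by
      rw [div_mul_eq_mul_div, one_mul, lt_div_iff₀ (by positivity), one_mul]
      exact pow_lt_pow_left₀ (by linarith) hε.le (by norm_num)
    unfold bodyFun at hx
    linarith

/-! ### Separating the test functionals on unit vectors -/

/-- The `j`-th unit vector of `c₀`. -/
noncomputable def unitVec (j : ℕ) : C₀(ℕ, ℝ) where
  toFun := Pi.single j 1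
  continuous_toFun := continuous_of_discreteTopology
  zero_at_infty' := by
    rw [cocompact_eq_cofinite]
    refine tendsto_nhds_of_eventually_eq ?_
    rw [eventually_cofinite]
    refine (Set.finite_singleton j).subset fun n hn => ?_
    by_contra hne
    exact hn (Pi.single_eq_of_ne hne _)

theorem unitVec_self (j : ℕ) : unitVec j j = 1 := Pi.single_eq_same (M := fun _ : ℕ => ℝ) j 1

theorem unitVec_of_ne {j n : ℕ} (h : n ≠ j) : unitVec j n = 0 :=
  Pi.single_eq_of_ne (M := fun _ : ℕ => ℝ) h 1

theorem norm_unitVec_le (j : ℕ) : ‖unitVec j‖ ≤ 1 :=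
  ZeroAtInftyContinuousMap.norm_le_of_abs_apply_le zero_le_one fun n => by
    by_cases h : n = j
    · rw [h, unitVec_self, abs_one]
    · rw [unitVec_of_ne h, abs_zero]
      exact zero_le_one

theorem rowFun_unitVec (k j : ℕ) : rowFun k (unitVec j) = rowCoeff k j := by
  rw [rowFun_apply, tsum_eq_single j fun i hi => by rw [unitVec_of_ne hi, mul_zero],
    unitVec_self, mul_one]

/-- Unpairing never increases a number, so the coordinates used by the code of `k` are at most `k`.
-/
theorem codeFun_unitVec_of_lt {k j : ℕ} (h : k < j) : codeFun k.unpair.1 (unitVec j) = 0 := by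
  have h0 := Nat.unpair_left_le k
  have h1 := Nat.unpair_left_le k.unpair.1
  have h2 : codeFst k.unpair.1 ≤ k.unpair.1.unpair.1 := Nat.unpair_left_le _
  have h3 : codeSnd k.unpair.1 ≤ k.unpair.1.unpair.1 := Nat.unpair_right_le _
  rw [codeFun_apply, unitVec_of_ne (by omega), unitVec_of_ne (by omega)]
  simp

/-- A bounded combination of the test functionals whose coordinates vanish eventually is
trivial. -/
theorem eq_zero_of_tsum_testFun {a : ℕ → ℝ} {A : ℝ} (ha : ∀ k, |a k| ≤ A)
    (h : ∀ᶠ j in atTop, ∑' k, weight k * a k * testFun k (unitVec j) = 0) (k : ℕ) : a k = 0 := by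
  have hA : 0 ≤ A := (abs_nonneg _).trans (ha 0)
  -- Only indices `i ≥ j` see the `j`-th unit vector through their coded part, and there the weight
  -- `(1 / 16) ^ i` is at most `(1 / 2) ^ i * (1 / 8) ^ j`.
  have hcode : ∀ j i, ‖weight i * a i * codeFun i.unpair.1 (unitVec j)‖
      ≤ (1 / 2) ^ i * ((1 / 8) ^ j * (2 * A)) := by
    intro j i
    rcases lt_or_ge i j with hij | hij
    · rw [codeFun_unitVec_of_lt hij, mul_zero, norm_zero]
      positivity
    · rw [Real.norm_eq_abs, abs_mul, abs_mul, abs_of_pos (weight_pos i)]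
      have h1 : weight i ≤ (1 / 2) ^ i * (1 / 8) ^ j := by
        have e : (1 / 16 : ℝ) ^ i ≤ (1 / 2) ^ i * (1 / 8) ^ j := by
          rw [show (1 / 16 : ℝ) = 1 / 2 * (1 / 8) by norm_num, mul_pow]
          gcongr _ * ?_
          exact pow_le_pow_of_le_one (by norm_num) (by norm_num) hij
        unfold weight
        have : (0 : ℝ) ≤ (1 / 16) ^ i := by positivity
        linarith
      have h2 : |codeFun i.unpair.1 (unitVec j)| ≤ 2 := by
        have := abs_codeFun_le i.unpair.1 (unitVec j)
        linarith [norm_unitVec_le j]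
      calc weight i * |a i| * |codeFun i.unpair.1 (unitVec j)|
          ≤ ((1 / 2) ^ i * (1 / 8) ^ j) * A * 2 := by
            have := ha i
            have := weight_pos i
            gcongr
        _ = _ := by ring
  have hrow : ∀ j i, i ≠ j.unpair.1 → weight i * a i * rowCoeff i j = 0 := fun j i hi => by
    rw [rowCoeff, if_neg (Ne.symm hi), mul_zero]
  -- The rows are disjoint, so just one perturbation sees the unit vector, with coefficient `(1 / 4)
  -- ^ j`. This dominates the coded parts, of order `(1 / 8) ^ j`; the quotient `(1 / 2) ^ j`
  -- remains.
  have key : ∀ᶠ j in atTop,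
      |weight j.unpair.1 * a j.unpair.1| ≤ 4 * A * (1 / 2) ^ j := by
    filter_upwards [h] with j hj
    have hs : Summable fun i => weight i * a i * codeFun i.unpair.1 (unitVec j) :=
      .of_norm_bounded (summable_half.mul_right _) (hcode j)
    have hs' : Summable fun i => weight i * a i * rowCoeff i j :=
      (hasSum_single j.unpair.1 (hrow j)).summable
    simp only [testFun_apply, rowFun_unitVec, mul_add] at hj
    rw [hs.tsum_add hs', tsum_eq_single _ (hrow j), rowCoeff, if_pos rfl] at hj
    have h1 := tsum_of_norm_bounded (summable_half.mul_right _).hasSum (hcode j)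
    rw [tsum_mul_right, tsum_geometric_of_lt_one (by norm_num) (by norm_num),
      eq_neg_of_add_eq_zero_left hj, norm_neg, norm_mul, Real.norm_eq_abs, norm_pow] at h1
    have e : (1 / 8 : ℝ) ^ j = (1 / 4) ^ j * (1 / 2) ^ j := by
      rw [← mul_pow]
      norm_num
    have h4 : (0 : ℝ) < (1 / 4) ^ j := by positivity
    rw [e, Real.norm_eq_abs, abs_of_pos (by norm_num : (0 : ℝ) < 1 / 4)] at h1
    refine le_of_mul_le_mul_right (h1.trans_eq ?_) h4
    ring
  -- Row `k` is infinite, so `j` may tend to infinity along it.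
  have hpair : Tendsto (fun i => Nat.pair k i) atTop atTop :=
    tendsto_atTop_mono (Nat.right_le_pair k) tendsto_id
  have hlim : Tendsto (fun i => 4 * A * (1 / 2 : ℝ) ^ Nat.pair k i) atTop (𝓝 0) := by
    have := ((tendsto_pow_atTop_nhds_zero_of_lt_one (r := (1 / 2 : ℝ)) (by norm_num)
      (by norm_num)).comp hpair).const_mul (4 * A)
    simpa using this
  have h1 : |weight k * a k| ≤ 0 := by
    refine ge_of_tendsto hlim ?_
    filter_upwards [hpair.eventually key] with i hi
    simpa using hi
  have h2 : weight k * a k = 0 := abs_eq_zero.1 (le_antisymm h1 (abs_nonneg _))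
  exact (mul_eq_zero.1 h2).resolve_left (weight_pos k).ne'

/-! ### Linear relations between gradients at three points -/

section relation

variable {ε l₁ l₂ l₃ : ℝ} {x₁ x₂ x₃ : C₀(ℕ, ℝ)}

/-- Evaluated at unit vectors beyond the finitely many coordinates of modulus above `1`, the
gradients of the wells vanish and only the test functionals remain. -/
theorem evenPowDeriv_relation
    (h : ∀ y, l₃ * bodyGrad ε x₃ y = l₁ * bodyGrad ε x₁ y + l₂ * bodyGrad ε x₂ y) (k : ℕ) :
    l₃ * evenPowDeriv (testParity k) (testFun k x₃) =
      l₁ * evenPowDeriv (testParity k) (testFun k x₁)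
        + l₂ * evenPowDeriv (testParity k) (testFun k x₂) := by
  have hbd : ∀ x : C₀(ℕ, ℝ), ∃ B, ∀ k, |evenPowDeriv (testParity k) (testFun k x)| ≤ B :=
    fun x => ⟨_, fun k => abs_evenPowDeriv_le (testParity k) (B := 1 + 4 * ‖x‖)
      (le_add_of_nonneg_right (by positivity)) ((abs_testFun_le k x).trans (by linarith))⟩
  obtain ⟨B₁, hB₁⟩ := hbd x₁
  obtain ⟨B₂, hB₂⟩ := hbd x₂
  obtain ⟨B₃, hB₃⟩ := hbd x₃
  have key := eq_zero_of_tsum_testFun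
    (a := fun k => l₁ * evenPowDeriv (testParity k) (testFun k x₁)
      + l₂ * evenPowDeriv (testParity k) (testFun k x₂)
      - l₃ * evenPowDeriv (testParity k) (testFun k x₃))
    (A := |l₁| * B₁ + |l₂| * B₂ + |l₃| * B₃) (fun k => ?_) ?_ k
  · linarith
  · refine (abs_sub _ _).trans (add_le_add ((abs_add_le _ _).trans (add_le_add ?_ ?_)) ?_) <;>
      rw [abs_mul] <;> gcongr
    · exact hB₁ k
    · exact hB₂ k
    · exact hB₃ k
  · have hflat : ∀ x : C₀(ℕ, ℝ), ∀ᶠ j in atTop,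
        ∑' n, flatWellDeriv (1 / ε ^ 2) (x n) * unitVec j n = 0 := fun x => by
      rw [← Nat.cofinite_eq_atTop]
      filter_upwards [(x.finite_lt_abs one_pos).compl_mem_cofinite] with j hj
      rw [tsum_eq_single j fun i hi => by rw [unitVec_of_ne hi, mul_zero],
        flatWellDeriv_eq_zero _ (not_lt.1 hj), zero_mul]
    filter_upwards [hflat x₁, hflat x₂, hflat x₃] with j h1 h2 h3
    have hj := h (unitVec j)
    simp only [bodyGrad_apply, h1, h2, h3, zero_add] at hj
    have s1 := (isGradientSum_testFun.summable_deriv x₁ (unitVec j)).mul_left l₁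
    have s2 := (isGradientSum_testFun.summable_deriv x₂ (unitVec j)).mul_left l₂
    have s3 := (isGradientSum_testFun.summable_deriv x₃ (unitVec j)).mul_left l₃
    rw [← tsum_mul_left, ← tsum_mul_left, ← tsum_mul_left, ← s1.tsum_add s2] at hj
    rw [← sub_eq_zero.2 hj.symm, ← (s1.add s2).tsum_sub s3]
    exact tsum_congr fun k => by ring

theorem continuous_evenPowDeriv (b : Prop) [Decidable b] : Continuous (evenPowDeriv b) := by
  unfold evenPowDeriv
  split_ifs <;> fun_prop

theorem codeFun_relation
    (h : ∀ y, l₃ * bodyGrad ε x₃ y = l₁ * bodyGrad ε x₁ y + l₂ * bodyGrad ε x₂ y) (c : ℕ) :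
    l₃ * evenPowDeriv (codeParity c) (codeFun c x₃) =
      l₁ * evenPowDeriv (codeParity c) (codeFun c x₁)
        + l₂ * evenPowDeriv (codeParity c) (codeFun c x₂) := by
  have ht : ∀ x, Tendsto (fun i => evenPowDeriv (codeParity c) (testFun (Nat.pair c i) x)) atTop
      (𝓝 (evenPowDeriv (codeParity c) (codeFun c x))) := fun x =>
    ((continuous_evenPowDeriv _).tendsto _).comp (tendsto_testFun c x)
  refine tendsto_nhds_unique ((ht x₃).const_mul l₃)
    ((((ht x₁).const_mul l₁).add ((ht x₂).const_mul l₂)).congr fun i => ?_)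
  have := evenPowDeriv_relation h (Nat.pair c i)
  have hp : testParity (Nat.pair c i) ↔ codeParity c := by
    rw [testParity, Nat.unpair_pair]
  simp only [evenPowDeriv, hp] at this ⊢
  exact this.symm

theorem exists_code (m n r : ℕ) (hr : r < 3) (b : Prop) [Decidable b] :
    ∃ c, (codeParity c ↔ b) ∧ ∀ x, codeFun c x = x m + ((r : ℝ) - 1) * x n := by
  -- The number `4 * r`, plus `3` or `0`, has residue `r` modulo `3`, while its parity is free.
  refine ⟨Nat.pair (Nat.pair m n) (4 * r + if b then 3 else 0), ?_, fun x => ?_⟩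
  · simp only [codeParity, Nat.unpair_pair]
    split_ifs with hb <;> simp only [hb, iff_true, iff_false] <;> omega
  · have : (4 * r + if b then 3 else 0) % 3 = r := by split_ifs <;> omega
    simp only [codeFun_apply, codeFst, codeSnd, codeCoeff, Nat.unpair_pair, this]

/-- The square gives a linear relation and the fourth power a cubic one; cubing the former
eliminates `x₃`. -/
theorem cubic_relation
    (h : ∀ y, l₃ * bodyGrad ε x₃ y = l₁ * bodyGrad ε x₁ y + l₂ * bodyGrad ε x₂ y)
    (m n : ℕ) {r : ℕ} (hr : r < 3) :
    (l₁ * (x₁ m + ((r : ℝ) - 1) * x₁ n) + l₂ * (x₂ m + ((r : ℝ) - 1) * x₂ n)) ^ 3 =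
      l₃ ^ 2 * (l₁ * (x₁ m + ((r : ℝ) - 1) * x₁ n) ^ 3
        + l₂ * (x₂ m + ((r : ℝ) - 1) * x₂ n) ^ 3) := by
  obtain ⟨c, hc, hx⟩ := exists_code m n r hr True
  obtain ⟨d, hd, hy⟩ := exists_code m n r hr False
  have h3 := codeFun_relation h c
  have h1 := codeFun_relation h d
  simp only [evenPowDeriv, hc, hd, if_true, if_false, hx, hy] at h1 h3
  have h1' : l₁ * (x₁ m + ((r : ℝ) - 1) * x₁ n) + l₂ * (x₂ m + ((r : ℝ) - 1) * x₂ n) =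
    l₃ * (x₃ m + ((r : ℝ) - 1) * x₃ n) := by linarith
  have h3' : l₁ * (x₁ m + ((r : ℝ) - 1) * x₁ n) ^ 3 + l₂ * (x₂ m + ((r : ℝ) - 1) * x₂ n) ^ 3 =
    l₃ * (x₃ m + ((r : ℝ) - 1) * x₃ n) ^ 3 := by linarith
  rw [h1', h3']
  ring

/-- A binary cubic form vanishing in four distinct directions is zero, so the identity extends to
the span of `(a, b)` and `(c, d)`. If `a * d ≠ b * c` this span is the plane, where the identity
fails. -/
theorem cross_eq_of_cubic {l₁ l₂ l₃ a b c d : ℝ} (hl₁ : l₁ ≠ 0) (hl₂ : l₂ ≠ 0)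
    (h0 : (l₁ * a + l₂ * b) ^ 3 = l₃ ^ 2 * (l₁ * a ^ 3 + l₂ * b ^ 3))
    (h0' : (l₁ * c + l₂ * d) ^ 3 = l₃ ^ 2 * (l₁ * c ^ 3 + l₂ * d ^ 3))
    (hp : (l₁ * (a + c) + l₂ * (b + d)) ^ 3 = l₃ ^ 2 * (l₁ * (a + c) ^ 3 + l₂ * (b + d) ^ 3))
    (hm : (l₁ * (a - c) + l₂ * (b - d)) ^ 3 = l₃ ^ 2 * (l₁ * (a - c) ^ 3 + l₂ * (b - d) ^ 3)) :
    a * d = b * c := by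
  have hspan : ∀ σ τ : ℝ, (l₁ * (σ * a + τ * c) + l₂ * (σ * b + τ * d)) ^ 3 =
      l₃ ^ 2 * (l₁ * (σ * a + τ * c) ^ 3 + l₂ * (σ * b + τ * d) ^ 3) := by
    intro σ τ
    linear_combination (σ ^ 3 - σ * τ ^ 2) * h0 + (τ ^ 3 - σ ^ 2 * τ) * h0'
      + (σ ^ 2 * τ + σ * τ ^ 2) / 2 * hp + (σ * τ ^ 2 - σ ^ 2 * τ) / 2 * hm
  -- With `Δ = a * d - b * c`, the three choices produce the pairs `(Δ, 0)`, `(Δ, Δ)` and `(Δ, -Δ)`.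
  -- In the second difference the right-hand sides cancel and `6 * l₁ * l₂ ^ 2 * Δ ^ 3` survives.
  have e0 := hspan d (-b)
  have ep := hspan (d - c) (a - b)
  have em := hspan (d + c) (-a - b)
  have : 6 * l₁ * l₂ ^ 2 * (a * d - b * c) ^ 3 = 0 := by
    linear_combination ep + em - 2 * e0
  have : (a * d - b * c) ^ 3 = 0 := by
    refine (mul_eq_zero.1 this).resolve_left ?_
    positivity
  linarith [pow_eq_zero_iff (three_ne_zero) |>.1 this]

/-- Gradients at three points are linearly related only if the points are parallel. -/
theorem parallel_of_bodyGrad_relation (hl₁ : l₁ ≠ 0) (hl₂ : l₂ ≠ 0) (hx : x₁ ≠ 0)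
    (h : ∀ y, l₃ * bodyGrad ε x₃ y = l₁ * bodyGrad ε x₁ y + l₂ * bodyGrad ε x₂ y) :
    ∃ a : ℝ, x₂ = a • x₁ := by
  have key : ∀ m n, x₁ m * x₂ n = x₂ m * x₁ n := fun m n => by
    refine cross_eq_of_cubic (l₃ := l₃) hl₁ hl₂ ?_ ?_ ?_ ?_
    · simpa using cubic_relation h m n (r := 1) (by norm_num)
    · simpa using cubic_relation h n m (r := 1) (by norm_num)
    · have := cubic_relation h m n (r := 2) (by norm_num)
      norm_num at this
      exact this
    · have := cubic_relation h m n (r := 0) (by norm_num)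
      simpa [sub_eq_add_neg] using this
  obtain ⟨n, hn⟩ : ∃ n, x₁ n ≠ 0 := by
    by_contra! h0
    exact hx (ZeroAtInftyContinuousMap.ext h0)
  refine ⟨x₂ n / x₁ n, ZeroAtInftyContinuousMap.ext fun m => ?_⟩
  rw [ZeroAtInftyContinuousMap.smul_apply, smul_eq_mul, div_mul_eq_mul_div, eq_div_iff hn]
  linarith [key m n]

end relation

/-! ### Planes meeting a set without nontrivial combinations -/

section planes

variable {V : Type*} [NormedAddCommGroup V] [NormedSpace ℝ V] {N : Set V}

/-- A set without nontrivial linear combinations of its members meets a plane in at most two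
lines. -/
theorem exists_lines_of_no_combination
    (hN : ∀ f ∈ N, ∀ g ∈ N, LinearIndependent ℝ ![f, g] → ∀ a b : ℝ, a ≠ 0 → b ≠ 0 →
      a • f + b • g ∉ N)
    {Z : Submodule ℝ V} (hZ : Module.finrank ℝ Z = 2) :
    ∃ L₁ L₂ : Submodule ℝ V, Module.finrank ℝ L₁ = 1 ∧ Module.finrank ℝ L₂ = 1 ∧
      (Z : Set V) ∩ N ⊆ (L₁ : Set V) ∪ L₂ := by
  by_cases hex : ∃ f ∈ (Z : Set V) ∩ N, ∃ g ∈ (Z : Set V) ∩ N, LinearIndependent ℝ ![f, g]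
  · obtain ⟨f, hf, g, hg, hfg⟩ := hex
    refine ⟨ℝ ∙ f, ℝ ∙ g, finrank_span_singleton (hfg.ne_zero 0),
      finrank_span_singleton (hfg.ne_zero 1), fun h hh => ?_⟩
    have : FiniteDimensional ℝ Z := Module.finite_of_finrank_pos (by omega)
    have hspan : Submodule.span ℝ {f, g} = Z := by
      refine Submodule.eq_of_le_of_finrank_eq ?_ ?_
      · rw [Submodule.span_le]
        rintro y (rfl | rfl)
        exacts [hf.1, hg.1]
      · have := finrank_span_eq_card hfg
        rw [Matrix.range_cons, Matrix.range_cons, Matrix.range_empty, Set.union_empty,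
          Set.singleton_union] at this
        rw [this, hZ, Fintype.card_fin]
    have hmem : h ∈ Submodule.span ℝ {f, g} := hspan ▸ hh.1
    obtain ⟨a, b, rfl⟩ := Submodule.mem_span_pair.1 hmem
    by_cases ha : a = 0
    · right
      simpa [ha] using Submodule.smul_mem _ b (Submodule.mem_span_singleton_self g)
    by_cases hb : b = 0
    · left
      simpa [hb] using Submodule.smul_mem _ a (Submodule.mem_span_singleton_self f)
    exact absurd hh.2 (hN f hf.2 g hg.2 hfg a b ha hb)
  · push Not at hex
    have hone : ∃ v : V, v ≠ 0 ∧ (Z : Set V) ∩ N ⊆ (ℝ ∙ v : Submodule ℝ V) := by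
      by_cases h0 : ∃ f ∈ (Z : Set V) ∩ N, f ≠ 0
      · obtain ⟨f, hf, hf0⟩ := h0
        refine ⟨f, hf0, fun g hg => ?_⟩
        have := hex f hf g hg
        rw [LinearIndependent.pair_iff' hf0] at this
        push Not at this
        exact Submodule.mem_span_singleton.2 this
      -- The intersection is at most `{0}` here, so any line in `Z` serves.
      · push Not at h0
        have : Nontrivial Z := Module.nontrivial_of_finrank_pos (R := ℝ) (by omega)
        obtain ⟨z, hz⟩ := exists_ne (0 : Z)
        refine ⟨z, by simpa using hz, fun g hg => ?_⟩
        rw [h0 g hg]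
        exact Submodule.zero_mem _
    obtain ⟨v, hv, hsub⟩ := hone
    exact ⟨ℝ ∙ v, ℝ ∙ v, finrank_span_singleton hv, finrank_span_singleton hv,
      hsub.trans Set.subset_union_left⟩

theorem encard_line_inter_sphere_le {L : Submodule ℝ V} (hL : Module.finrank ℝ L = 1) :
    {f : V | f ∈ L ∧ ‖f‖ = 1}.encard ≤ 2 := by
  by_cases hex : ∃ v ∈ L, ‖v‖ = 1
  · obtain ⟨v, hv, hv1⟩ := hex
    refine (Set.encard_le_encard (t := {v, -v}) ?_).trans
      ((Set.encard_insert_le _ _).trans (by rw [Set.encard_singleton, one_add_one_eq_two]))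
    rintro f ⟨hf, hf1⟩
    have hv0 : (⟨v, hv⟩ : L) ≠ 0 := fun h => by
      have : v = 0 := congrArg Subtype.val h
      simp [this] at hv1
    obtain ⟨c, hc⟩ := (finrank_eq_one_iff_of_nonzero' _ hv0).1 hL ⟨f, hf⟩
    have hc : c • v = f := congrArg Subtype.val hc
    rw [← hc, norm_smul, hv1, mul_one, Real.norm_eq_abs] at hf1
    rcases eq_or_eq_neg_of_abs_eq hf1 with rfl | rfl
    · left
      rw [← hc, one_smul]
    · right
      rw [← hc, neg_one_smul]
      rfl
  · push Not at hex
    rw [Set.encard_eq_zero.2 (Set.eq_empty_of_forall_notMem fun f hf => hex f hf.1 hf.2)]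
    exact zero_le

theorem encard_plane_inter_sphere_le
    (hN : ∀ f ∈ N, ∀ g ∈ N, LinearIndependent ℝ ![f, g] → ∀ a b : ℝ, a ≠ 0 → b ≠ 0 →
      a • f + b • g ∉ N)
    {Z : Submodule ℝ V} (hZ : Module.finrank ℝ Z = 2) :
    ({f : V | f ∈ Z ∧ ‖f‖ = 1} ∩ N).encard ≤ 4 := by
  obtain ⟨L₁, L₂, h1, h2, hsub⟩ := exists_lines_of_no_combination hN hZ
  calc ({f : V | f ∈ Z ∧ ‖f‖ = 1} ∩ N).encard
      ≤ ({f : V | f ∈ L₁ ∧ ‖f‖ = 1} ∪ {f : V | f ∈ L₂ ∧ ‖f‖ = 1}).encard := by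
        refine Set.encard_le_encard ?_
        rintro f ⟨⟨hf, hf1⟩, hfN⟩
        rcases hsub ⟨hf, hfN⟩ with h | h
        exacts [Or.inl ⟨h, hf1⟩, Or.inr ⟨h, hf1⟩]
    _ ≤ 2 + 2 := (Set.encard_union_le _ _).trans
        (add_le_add (encard_line_inter_sphere_le h1) (encard_line_inter_sphere_le h2))
    _ = 4 := by norm_num

end planes

/-! ### Combinations of norm attaining functionals -/

/-- No nontrivial combination of independent norm attaining functionals is norm attaining. -/
theorem combination_notMem_normAttaining {ε : ℝ} (hε : 0 < ε) (hR : 0 < 1 + ε) :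
    ∀ f ∈ NormAttaining (Renormed ((isSmoothBody hε).norm hR)),
    ∀ g ∈ NormAttaining (Renormed ((isSmoothBody hε).norm hR)),
    LinearIndependent ℝ ![f, g] → ∀ a b : ℝ, a ≠ 0 → b ≠ 0 →
      a • f + b • g ∉ NormAttaining (Renormed ((isSmoothBody hε).norm hR)) := by
  intro f hf g hg hfg a b ha hb hmem
  have H := isSmoothBody hε
  obtain ⟨x, hx, hfx⟩ := hf
  obtain ⟨y, hy, hgy⟩ := hg
  obtain ⟨z, hz, hhz⟩ := hmem
  have ef := H.eq_smul_of_attains hR f hx hfx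
  have eg := H.eq_smul_of_attains hR g hy hgy
  have eh := H.eq_smul_of_attains hR _ hz hhz
  have hf0 : f x ≠ 0 := fun h0 => by
    rw [h0, abs_zero, norm_eq_zero] at hfx
    exact hfg.ne_zero 0 hfx
  have hg0 : g y ≠ 0 := fun h0 => by
    rw [h0, abs_zero, norm_eq_zero] at hgy
    exact hfg.ne_zero 1 hgy
  have hDx := H.apply_self_pos (x := (Renormed.of (H.norm hR)).symm x) hx
  have hDy := H.apply_self_pos (x := (Renormed.of (H.norm hR)).symm y) hy
  have hx0 : (Renormed.of (H.norm hR)).symm x ≠ 0 := fun h0 => by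
    rw [h0, map_zero] at hDx
    exact lt_irrefl _ hDx
  obtain ⟨c, hc⟩ := parallel_of_bodyGrad_relation
    (x₂ := (Renormed.of (H.norm hR)).symm y) (mul_ne_zero ha (div_ne_zero hf0 hDx.ne'))
    (mul_ne_zero hb (div_ne_zero hg0 hDy.ne')) hx0 fun w => by
      rw [← eh w, add_apply, smul_apply, smul_apply, smul_eq_mul, smul_eq_mul, ef w, eg w]
      ring
  have hyx : y = c • x := by
    rw [← map_smul] at hc
    exact (Renormed.of (H.norm hR)).symm.injective hc
  have hc1 : |c| = 1 := by
    rw [hyx, norm_smul, hx, mul_one] at hy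
    exact hy
  -- Since `y = ± x`, the functional `g` also attains its norm at `x`, which makes it a multiple of
  -- the same gradient as `f`.
  have eg' := H.eq_smul_of_attains hR g hx (by
    rw [hgy, hyx, map_smul, smul_eq_mul, abs_mul, hc1, one_mul])
  have hpar : (g x / f x) • f = g := by
    ext w
    obtain ⟨v, rfl⟩ := (Renormed.of (H.norm hR)).surjective w
    rw [smul_apply, smul_eq_mul, ef v, eg' v]
    field_simp
  exact (LinearIndependent.pair_iff' (hfg.ne_zero 0)).1 hfg _ hpar

theorem mainTheorem5 (ε : ℝ) (hε : 0 < ε) :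
    ∃ p : VectorNorm C₀(ℕ, ℝ),
      EpsEquivalent ε p ∧
      CompleteSpace (Renormed p) ∧
      (∀ Z : Submodule ℝ (StrongDual ℝ (Renormed p)), Module.finrank ℝ Z = 2 →
        ∃ L₁ L₂ : Submodule ℝ (StrongDual ℝ (Renormed p)),
          Module.finrank ℝ L₁ = 1 ∧ Module.finrank ℝ L₂ = 1 ∧
          (Z : Set (StrongDual ℝ (Renormed p))) ∩ NormAttaining (Renormed p) ⊆
            (L₁ : Set (StrongDual ℝ (Renormed p))) ∪ L₂) ∧
      (∀ Z : Submodule ℝ (StrongDual ℝ (Renormed p)), Module.finrank ℝ Z = 2 →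
        ({f : StrongDual ℝ (Renormed p) | f ∈ Z ∧ ‖f‖ = 1} ∩
          NormAttaining (Renormed p)).encard ≤ 4) ∧
      (∀ f ∈ NormAttaining (Renormed p), ∀ g ∈ NormAttaining (Renormed p),
        LinearIndependent ℝ ![f, g] →
        ∀ h ∈ openSegment ℝ f g, h ∉ NormAttaining (Renormed p)) := by
  have hR : 0 < 1 + ε := by linarith
  have hN := combination_notMem_normAttaining hε hR
  refine ⟨(isSmoothBody hε).norm hR, (isSmoothBody hε).epsEquivalent hR le_rfl,
    (isSmoothBody hε).completeSpace hR, fun Z hZ => exists_lines_of_no_combination hN hZ,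
    fun Z hZ => encard_plane_inter_sphere_le hN hZ, ?_⟩
  rintro f hf g hg hfg h ⟨a, b, ha, hb, -, rfl⟩
  exact hN f hf g hg hfg a b ha.ne' hb.ne'
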